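/- An electric circuit with one battery is a finite connected graph (multiple edges allowed), one edge of which, the battery, has distinct ends marked $+$ and $-$; the other edges are the resistors. The battery carries a positive number $U$ (its voltage), and every resistor $e$ a positive number $\rho_e$ (its resistance). Assume that the two poles of the battery are joined by a chain of resistors, i.e. that the battery is not a bridge of the graph. Choose a direction on every resistor, and direct the battery from $-$ to $+$. The currents through the edges are real numbers subject to Kirchhoff's rules: (1) at every vertex the sum of the incoming currents equals the sum of the outgoing ones; (2) along every closed walk, the algebraic sum of the voltages (current times resistance) on the resistors equals the algebraic sum of the voltages of the battery, each voltage being taken with the sign $+$ when the edge is traversed in its chosen direction, and $-$ otherwise. For a circuit drawn in the plane, rule (2) is alternatively required only for the contours, i.e. the boundaries of the bounded faces of the drawing, traversed counterclockwise. The total resistance of the circuit is the ratio of $U$ to the current through the battery. **Theorem.** For every such graph there is a formula, built from the variables $(\rho_e)$ using only the operations $+,-,\times,\div$, that expresses the total resistance through the resistances of the individual resistors. In other words, the total resistance is a ratio $p/q$ of two polynomials in the $\rho_e$ with integer coefficients. The formula and the polynomials $p,q$ depend only on the graph. More precisely, for all positive $\rho_e$ and $U$, Kirchhoff's equations have exactly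 one solution, the current through the battery is nonzero in it, no division by zero occurs in the formula, $q(\rho)\neq 0$, and the total resistance equals both the value of the formula and $p(\rho)/q(\rho)$. For a graph drawn in the plane all this holds, with the same formula and the same $p,q$, whether rule (2) is required for all closed walks or only for the contours. -/

import Mathlib

/-- The graph underlying an electric circuit with one battery: a finite connected graph (several
edges between two vertices are allowed) with vertex set `V` (the terminals). Its edges are the
resistors `some e`, `e : E`, and the battery `none`. On every resistor one of the two
directions has been chosen arbitrarily. The poles of the battery are distinct. The resistances and
the voltage of the battery are kept apart from the graph. -/
structure CircuitGraph (V E : Type*) where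
  /-- the starting point of a resistor in its chosen direction -/
  tail : E → V
  /-- the end point of a resistor in its chosen direction -/
  head : E → V
  /-- the positive pole of the battery -/
  pos : V
  /-- the negative pole of the battery -/
  neg : V
  pos_ne_neg : pos ≠ neg
  /-- The graph, with the battery among its edges, is connected. -/
  connected : ∀ u v : V, Relation.EqvGen
    (fun a b => (a = neg ∧ b = pos) ∨ ∃ e, a = tail e ∧ b = head e) u v

namespace CircuitGraph

variable {V E : Type*} (C : CircuitGraph V E)

/-- The starting point of an edge; the battery is directed from the negative to the positive pole. -/
def start : Option E → V
  | none => C.neg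
  | some e => C.tail e

/-- The end point of an edge. -/
def finish : Option E → V
  | none => C.pos
  | some e => C.head e

/-- The poles of the battery are joined by a chain of resistors, that is, the battery is not a
bridge of the graph. -/
def PolesJoined : Prop :=
  Relation.EqvGen (fun a b => ∃ e, a = C.tail e ∧ b = C.head e) C.pos C.neg

/-- A directed edge: `(a, true)` is the edge `a` with its chosen direction, `(a, false)` is the edge
`a` with the opposite direction. -/
abbrev Dart (E : Type*) := Option E × Bool

/-- The vertex at which a directed edge begins. -/
def src (d : Dart E) : V := if d.2 then C.start d.1 else C.finish d.1

/-- The vertex at which a directed edge ends. -/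
def tgt (d : Dart E) : V := if d.2 then C.finish d.1 else C.start d.1

/-- The same edge with the opposite direction. -/
def rev : Equiv.Perm (Dart E) := Equiv.prodCongr (Equiv.refl _) Equiv.boolNot

/-- `1` if the direction agrees with the chosen one and `-1` otherwise. -/
def sign (d : Dart E) : ℝ := if d.2 then 1 else -1

/-- The signed voltage (current times resistance) on a directed edge if it is a resistor. -/
def resistorVoltage (ρ : E → ℝ) (J : Option E → ℝ) (d : Dart E) : ℝ :=
  match d.1 with
  | none => 0
  | some e => sign d * (J (some e) * ρ e)

/-- The signed voltage on a directed edge if it is the battery, whose voltage is `U`. -/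
def batteryVoltage (U : ℝ) (d : Dart E) : ℝ :=
  match d.1 with
  | none => sign d * U
  | some _ => 0

open scoped Classical in
/-- First Kirchhoff rule: at each vertex the sum of the incoming currents equals the sum of the
outgoing ones. Here `J a` is the current through the edge `a` in its chosen direction. -/
def FirstRule [Fintype E] (J : Option E → ℝ) : Prop :=
  ∀ v : V, ∑ a with C.finish a = v, J a = ∑ a with C.start a = v, J a

/-- `l` is a walk from `u` to `v`. -/
def IsWalk : V → List (Dart E) → V → Prop
  | u, [], v => u = v
  | u, d :: l, v => C.src d = u ∧ IsWalk (C.tgt d) l v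

/-- Second Kirchhoff rule for all closed walks: the algebraic sum of the voltages on the
resistors equals the algebraic sum of the voltages on the battery. -/
def SecondRule (ρ : E → ℝ) (U : ℝ) (J : Option E → ℝ) : Prop :=
  ∀ (u : V) (l : List (Dart E)), C.IsWalk u l u →
    (l.map (resistorVoltage ρ J)).sum = (l.map (batteryVoltage U)).sum

/-- The Kirchhoff equations of an arbitrary circuit. -/
def Kirchhoff [Fintype E] (ρ : E → ℝ) (U : ℝ) (J : Option E → ℝ) : Prop :=
  C.FirstRule J ∧ C.SecondRule ρ U J

/-- A drawing of the circuit in the plane, given by its rotation system. -/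
structure PlaneDrawing (C : CircuitGraph V E) where
  /-- the next directed edge, counterclockwise, among those with the same starting vertex -/
  next : Equiv.Perm (Dart E)
  next_sameCycle_iff : ∀ d d' : Dart E, next.SameCycle d d' ↔ C.src d = C.src d'
  /-- a directed edge on whose left the unbounded face lies -/
  outer : Dart E
  /-- Euler's formula (the rotation system has genus zero). The faces are the cycles of the
  permutation that sends a directed edge to the following one on the boundary of the face
  on its left. -/
  euler : Nat.card V + Nat.card (Quotient (Equiv.Perm.SameCycle.setoid (rev.trans next.symm))) =
    Nat.card (Option E) + 2

namespace PlaneDrawing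

variable {C}
variable (M : C.PlaneDrawing)

/-- The directed edge that follows a given one when the boundary of the face on its left is traversed
with the face kept on the left (counterclockwise if the face is bounded). -/
def facePerm : Equiv.Perm (Dart E) := rev.trans M.next.symm

open scoped Classical in
/-- Second Kirchhoff rule for contours, that is, for the boundaries of the bounded faces of the
drawing, traversed counterclockwise. The contour through `d` consists of all directed edges in
the cycle of `d`. -/
def SecondRule [Fintype E] (ρ : E → ℝ) (U : ℝ) (J : Option E → ℝ) : Prop :=
  ∀ d : Dart E, ¬ M.facePerm.SameCycle M.outer d →
    ∑ x with M.facePerm.SameCycle d x, resistorVoltage ρ J x =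
      ∑ x with M.facePerm.SameCycle d x, batteryVoltage U x

/-- The Kirchhoff equations of a plane circuit. -/
def Kirchhoff [Fintype E] (ρ : E → ℝ) (U : ℝ) (J : Option E → ℝ) : Prop :=
  C.FirstRule J ∧ M.SecondRule ρ U J

end PlaneDrawing

/-- `r` is the total resistance defined by the system of equations `K` for the currents: the system
has exactly one solution, the current through the battery is not zero in it, and `r` is the ratio of the
battery voltage `U` to this current. -/
def IsTotalResistance (K : (Option E → ℝ) → Prop) (U r : ℝ) : Prop :=
  ∃ J : Option E → ℝ, K J ∧ (∀ J', K J' → J' = J) ∧ J none ≠ 0 ∧ r = U / J none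

end CircuitGraph

/-- Formulas built from variables by the four arithmetic operations (without constants). -/
inductive ArithFormula (E : Type*) where
  | var (e : E) : ArithFormula E
  | add (a b : ArithFormula E) : ArithFormula E
  | sub (a b : ArithFormula E) : ArithFormula E
  | mul (a b : ArithFormula E) : ArithFormula E
  | div (a b : ArithFormula E) : ArithFormula E

namespace ArithFormula

variable {E : Type*}

/-- The value of a formula. -/
noncomputable def eval (ρ : E → ℝ) : ArithFormula E → ℝ
  | var e => ρ e
  | add a b => a.eval ρ + b.eval ρ
  | sub a b => a.eval ρ - b.eval ρ
  | mul a b => a.eval ρ * b.eval ρ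
  | div a b => a.eval ρ / b.eval ρ

/-- No division by zero occurs in the evaluation of the formula. -/
def Defined (ρ : E → ℝ) : ArithFormula E → Prop
  | var _ => True
  | add a b => a.Defined ρ ∧ b.Defined ρ
  | sub a b => a.Defined ρ ∧ b.Defined ρ
  | mul a b => a.Defined ρ ∧ b.Defined ρ
  | div a b => a.Defined ρ ∧ b.Defined ρ ∧ b.eval ρ ≠ 0

end ArithFormula

/-! The second rule says that the function `drop` (`J e * ρ e` on resistors, `-U` on the battery) is
the coboundary of a vertex function `h`. Kirchhoff's equations thus become a square linear system in
`(h, J)` with matrix `systemMatrix ρ`, whose entries are integers or variables. By the energy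
identity `FirstRule.sum_energy` its kernel is trivial for positive `ρ`, so Cramer's rule gives the
battery current as `U` times a cofactor over the determinant. The total resistance is the
determinant over that cofactor; the cofactor is nonzero because the poles are joined by resistors.

For a plane drawing, contours suffice by a discrete Hodge decomposition: coboundaries of vertex
functions and boundaries of face functions are orthogonal, and Euler's formula makes them span all
edge functions (`hodgeMap_surjective`). The contour rules make `drop` orthogonal to its own face
part, which therefore vanishes. -/

namespace CircuitGraph

open scoped Matrix

variable {V E : Type*} (C : CircuitGraph V E)

/-! ### Potentials -/

/-- The voltage drop prescribed on an edge: current times resistance on the resistors and minus the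
voltage of the battery on the battery. -/
def drop (ρ : E → ℝ) (U : ℝ) (J : Option E → ℝ) : Option E → ℝ
  | none => -U
  | some e => J (some e) * ρ e

lemma resistorVoltage_sub_batteryVoltage (ρ : E → ℝ) (U : ℝ) (J : Option E → ℝ) (d : Dart E) :
    resistorVoltage ρ J d - batteryVoltage U d = sign d * drop ρ U J d.1 := by
  obtain ⟨_ | e, b⟩ := d <;> simp [resistorVoltage, batteryVoltage, drop]

/-- `h` is a potential for the function `g` on the edges. -/
def IsPotential (g : Option E → ℝ) (h : V → ℝ) : Prop :=
  ∀ a, h (C.finish a) - h (C.start a) = g a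

lemma IsPotential.sign_mul {C : CircuitGraph V E} {g : Option E → ℝ} {h : V → ℝ}
    (H : C.IsPotential g h) (d : Dart E) : sign d * g d.1 = h (C.tgt d) - h (C.src d) := by
  obtain ⟨a, _ | _⟩ := d <;> simp [sign, tgt, src, ← H a]

lemma PolesJoined.apply_pos_eq {C : CircuitGraph V E} (hC : C.PolesJoined) {α : Type*} {k : V → α}
    (hk : ∀ e, k (C.tail e) = k (C.head e)) : k C.pos = k C.neg := by
  have key (u v : V) (h : Relation.EqvGen (fun a b => ∃ e, a = C.tail e ∧ b = C.head e) u v) :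
      k u = k v := by
    induction h with
    | rel a b hab => obtain ⟨e, rfl, rfl⟩ := hab; exact hk e
    | refl => rfl
    | symm _ _ _ ih => exact ih.symm
    | trans _ _ _ _ _ ih ih' => exact ih.trans ih'
  exact key _ _ hC

/-- Formulas contain no constants, so at least one variable is needed to write any formula at all.
-/
lemma PolesJoined.nonempty {C : CircuitGraph V E} (hC : C.PolesJoined) : Nonempty E := by
  by_contra hE
  exact C.pos_ne_neg (hC.apply_pos_eq (k := id) fun e => (hE ⟨e⟩).elim)

lemma eq_of_isPotential_zero {h : V → ℝ} (H : C.IsPotential 0 h) (u v : V) : h u = h v := by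
  induction C.connected u v with
  | rel a b hab =>
    rcases hab with ⟨rfl, rfl⟩ | ⟨e, rfl, rfl⟩
    · exact (sub_eq_zero.1 (H none)).symm
    · exact (sub_eq_zero.1 (H (some e))).symm
  | refl => rfl
  | symm _ _ _ ih => exact ih.symm
  | trans _ _ _ _ _ ih ih' => exact ih.trans ih'

lemma IsWalk.append {C : CircuitGraph V E} {u v w : V} {l m : List (Dart E)}
    (hl : C.IsWalk u l v) (hm : C.IsWalk v m w) : C.IsWalk u (l ++ m) w := by
  induction l generalizing u with
  | nil => obtain rfl : u = v := hl; exact hm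
  | cons d l ih => exact ⟨hl.1, ih hl.2⟩

lemma exists_isWalk (u v : V) : ∃ l, C.IsWalk u l v := by
  suffices H : (∃ l, C.IsWalk u l v) ∧ ∃ l, C.IsWalk v l u from H.1
  have key (a : Option E) : (∃ l, C.IsWalk (C.start a) l (C.finish a)) ∧
      ∃ l, C.IsWalk (C.finish a) l (C.start a) :=
    ⟨⟨[(a, true)], by simp [IsWalk, src, tgt]⟩, ⟨[(a, false)], by simp [IsWalk, src, tgt]⟩⟩
  induction C.connected u v with
  | rel a b hab =>
    rcases hab with ⟨rfl, rfl⟩ | ⟨e, rfl, rfl⟩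
    · exact key none
    · exact key (some e)
  | refl => exact ⟨⟨[], rfl⟩, ⟨[], rfl⟩⟩
  | symm _ _ _ ih => exact ih.symm
  | trans _ _ _ _ _ ih ih' =>
    obtain ⟨⟨l, hl⟩, m, hm⟩ := ih
    obtain ⟨⟨l', hl'⟩, m', hm'⟩ := ih'
    exact ⟨⟨_, hl.append hl'⟩, ⟨_, hm'.append hm⟩⟩

lemma IsPotential.sum_walk {C : CircuitGraph V E} {g : Option E → ℝ} {h : V → ℝ}
    (H : C.IsPotential g h) {u v : V} {l : List (Dart E)} (hl : C.IsWalk u l v) :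
    (l.map fun d => sign d * g d.1).sum = h v - h u := by
  induction l generalizing u with
  | nil => obtain rfl : u = v := hl; simp
  | cons d l ih =>
    obtain ⟨rfl, hl⟩ := hl
    rw [List.map_cons, List.sum_cons, ih hl, H.sign_mul]
    ring

/-- A function on the edges whose sum over every closed walk vanishes has a potential. -/
lemma exists_isPotential {g : Option E → ℝ}
    (H : ∀ u l, C.IsWalk u l u → (l.map fun d => sign d * g d.1).sum = 0) :
    ∃ h, C.IsPotential g h := by
  choose l hl using fun v => C.exists_isWalk C.neg v
  refine ⟨fun v => ((l v).map fun d => sign d * g d.1).sum, fun a => ?_⟩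
  -- The same return walk `m` closes both the walk to `C.finish a` and the walk to `C.start a`
  -- extended by `a`; comparing the two closed walks leaves the value on `a`.
  obtain ⟨m, hm⟩ := C.exists_isWalk (C.finish a) C.neg
  have h₁ := H _ _ ((hl (C.finish a)).append hm)
  have h₂ := H _ ((l (C.start a)) ++ (a, true) :: m)
    ((hl (C.start a)).append ⟨by simp [src], by simpa [tgt] using hm⟩)
  simp only [List.map_append, List.sum_append, List.map_cons, List.sum_cons] at h₁ h₂
  simp only [sign, if_true] at h₁ h₂ ⊢
  linarith

lemma secondRule_iff (ρ : E → ℝ) (U : ℝ) (J : Option E → ℝ) :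
    C.SecondRule ρ U J ↔ ∃ h, C.IsPotential (drop ρ U J) h := by
  have key (l : List (Dart E)) :
      (l.map (resistorVoltage ρ J)).sum = (l.map (batteryVoltage U)).sum ↔
        (l.map fun d => sign d * drop ρ U J d.1).sum = 0 := by
    simp only [← resistorVoltage_sub_batteryVoltage]
    rw [← sub_eq_zero]
    suffices H : (l.map (resistorVoltage ρ J)).sum - (l.map (batteryVoltage U)).sum =
        (l.map fun d => resistorVoltage ρ J d - batteryVoltage U d).sum by rw [H]
    induction l with
    | nil => simp
    | cons d l ih => simp only [List.map_cons, List.sum_cons, ← ih]; ring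
  simp only [SecondRule, key]
  refine ⟨C.exists_isPotential, ?_⟩
  rintro ⟨h, H⟩ u l hl
  rw [H.sum_walk hl, sub_self]

/-! ### Plane drawings -/

namespace PlaneDrawing

variable {C} (M : C.PlaneDrawing)

lemma src_next_symm (d : Dart E) : C.src (M.next.symm d) = C.src d :=
  (M.next_sameCycle_iff _ _).1 ⟨1, by simp⟩

lemma src_rev (d : Dart E) : C.src (rev d) = C.tgt d := by
  obtain ⟨a, _ | _⟩ := d <;> rfl

lemma src_facePerm (d : Dart E) : C.src (M.facePerm d) = C.tgt d :=
  (M.src_next_symm _).trans (src_rev d)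

/-- The sum of a coboundary with coefficients that are constant on the faces vanishes. -/
lemma sum_mul_tgt_sub_src [Fintype E] {c : Dart E → ℝ} (hc : ∀ d, c (M.facePerm d) = c d)
    (h : V → ℝ) : ∑ d, c d * (h (C.tgt d) - h (C.src d)) = 0 := by
  simp only [mul_sub, Finset.sum_sub_distrib, sub_eq_zero]
  -- Each dart ends where its successor on the face begins, so reindexing by `facePerm` matches the
  -- two sums.
  rw [← Equiv.sum_comp M.facePerm fun d => c d * h (C.src d)]
  simp only [hc, src_facePerm]

/-- `next` is generated by `facePerm` and `rev`, so `c` is constant around each vertex. It descends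
to a function on the vertices with equal values at the ends of every edge, and the graph is
connected. -/
lemma eq_of_face_eq_of_rev_eq {c : Dart E → ℝ} (hc : ∀ d, c (M.facePerm d) = c d)
    (hrev : ∀ d, c (rev d) = c d) (d d' : Dart E) : c d = c d' := by
  have hnext (d) : c (M.next d) = c d := by
    have := hc (rev (M.next d))
    have h2 : rev (rev (M.next d)) = M.next d := Prod.ext rfl (Bool.not_not _)
    rw [facePerm, Equiv.trans_apply, h2, Equiv.symm_apply_apply, hrev] at this
    exact this.symm
  have hpow (n : ℤ) (d) : c ((M.next ^ n) d) = c d := by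
    induction n generalizing d with
    | zero => rfl
    | succ n ih => rw [zpow_add_one, Equiv.Perm.mul_apply, ih, hnext]
    | pred n ih =>
      rw [zpow_sub_one, Equiv.Perm.mul_apply, ih, ← hnext (M.next⁻¹ d), ← Equiv.Perm.mul_apply,
        mul_inv_cancel, Equiv.Perm.one_apply]
  have hfac : Function.FactorsThrough c C.src := by
    intro d d' h
    obtain ⟨n, rfl⟩ := (M.next_sameCycle_iff d d').2 h
    exact (hpow n d).symm
  have hH : C.IsPotential 0 (Function.extend C.src c 0) := by
    intro a
    have h₁ := hfac.extend_apply 0 (a, true)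
    have h₂ := hfac.extend_apply 0 (a, false)
    simp only [src, if_true, Bool.false_eq_true, if_false] at h₁ h₂
    rw [h₁, h₂, Pi.zero_apply, sub_eq_zero]
    exact hrev (a, true)
  rw [← hfac.extend_apply 0 d, ← hfac.extend_apply 0 d']
  exact C.eq_of_isPotential_zero hH _ _

/-- The faces of the drawing. -/
abbrev Face : Type _ := Quotient (Equiv.Perm.SameCycle.setoid M.facePerm)

/-- The face on the left of a directed edge. -/
def face (d : Dart E) : M.Face := Quotient.mk _ d

lemma face_eq_iff {d d' : Dart E} : M.face d = M.face d' ↔ M.facePerm.SameCycle d d' :=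
  Quotient.eq

lemma face_facePerm (d : Dart E) : M.face (M.facePerm d) = M.face d :=
  M.face_eq_iff.2 (Equiv.Perm.SameCycle.refl _ _).apply_left

/-- The coboundary of a function on the vertices plus the boundary of a function on the faces, along
with the values at a vertex and at a face. -/
def hodgeMap : (V → ℝ) × (M.Face → ℝ) →ₗ[ℝ] (Option E → ℝ) × ℝ × ℝ where
  toFun x := (fun a => (x.1 (C.finish a) - x.1 (C.start a)) +
    (x.2 (M.face (a, true)) - x.2 (M.face (a, false))), x.1 C.pos, x.2 (M.face M.outer))
  map_add' x y := by
    ext <;> simp; ring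
  map_smul' t x := by
    ext <;> simp; ring

lemma sum_mul_face [Fintype E] (c : M.Face → ℝ) (g : Option E → ℝ) :
    ∑ a, g a * (c (M.face (a, true)) - c (M.face (a, false))) =
      ∑ d : Dart E, c (M.face d) * (sign d * g d.1) := by
  rw [Fintype.sum_prod_type]
  refine Finset.sum_congr rfl fun a _ => ?_
  simp [sign]
  ring

/-- Orthogonality of the two parts of `hodgeMap`: a coboundary sums to zero around each face. -/
lemma sum_coboundary_mul_face [Fintype E] (c : M.Face → ℝ) (h : V → ℝ) :
    ∑ a, (h (C.finish a) - h (C.start a)) * (c (M.face (a, true)) - c (M.face (a, false))) = 0 := by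
  rw [M.sum_mul_face c fun a => h (C.finish a) - h (C.start a)]
  have H : C.IsPotential (fun a => h (C.finish a) - h (C.start a)) h := fun _ => rfl
  simp only [H.sign_mul]
  exact M.sum_mul_tgt_sub_src (fun d => by rw [face_facePerm]) h

/-- By orthogonality, pairing `g` with its face part gives the squared norm of that part. -/
lemma face_eq_of_sum_mul_eq_zero [Fintype E] {c : M.Face → ℝ} {h : V → ℝ} {g : Option E → ℝ}
    (H : ∀ a, (h (C.finish a) - h (C.start a)) +
      (c (M.face (a, true)) - c (M.face (a, false))) = g a)
    (hg : ∑ a, g a * (c (M.face (a, true)) - c (M.face (a, false))) = 0) (a : Option E) :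
    c (M.face (a, true)) = c (M.face (a, false)) := by
  simp only [← H, add_mul, Finset.sum_add_distrib, M.sum_coboundary_mul_face c h, zero_add] at hg
  exact sub_eq_zero.1 (mul_self_eq_zero.1
    ((Finset.sum_eq_zero_iff_of_nonneg fun a _ => mul_self_nonneg _).1 hg a (Finset.mem_univ a)))

lemma hodgeMap_injective [Fintype E] : Function.Injective M.hodgeMap := by
  rw [injective_iff_map_eq_zero]
  rintro ⟨h, c⟩ H
  obtain ⟨H₁, H₂, H₃⟩ : (∀ a, (h (C.finish a) - h (C.start a)) +
      (c (M.face (a, true)) - c (M.face (a, false))) = 0) ∧ h C.pos = 0 ∧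
      c (M.face M.outer) = 0 := by
    simpa [hodgeMap, Prod.ext_iff, funext_iff] using H
  have hD := M.face_eq_of_sum_mul_eq_zero (g := 0) H₁ (by simp)
  have hh : h = 0 := by
    ext v
    exact (C.eq_of_isPotential_zero (h := h) (fun a => by simpa [hD a] using H₁ a) v C.pos).trans H₂
  have hc : c = 0 := by
    ext f
    obtain ⟨d, rfl⟩ := Quotient.exists_rep f
    refine Eq.trans ?_ H₃
    refine M.eq_of_face_eq_of_rev_eq (c := fun d => c (M.face d)) (fun d => by rw [face_facePerm])
      ?_ d M.outer
    rintro ⟨a, _ | _⟩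
    · exact hD a
    · exact (hD a).symm
  rw [hh, hc]
  rfl

/-- Euler's formula says precisely that source and target have equal dimension; the two extra real
coordinates account for the `+ 2`. -/
lemma hodgeMap_surjective [Fintype V] [Fintype E] : Function.Surjective M.hodgeMap := by
  classical
  have : Fintype M.Face := Fintype.ofFinite _
  refine (LinearMap.injective_iff_surjective_of_finrank_eq_finrank ?_).1 M.hodgeMap_injective
  have := M.euler
  change Nat.card V + Nat.card M.Face = _ at this
  simp only [Nat.card_eq_fintype_card] at this
  simp only [Module.finrank_prod, Module.finrank_fintype_fun_eq_card, Module.finrank_self]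
  omega

open scoped Classical in
lemma secondRule_iff [Fintype V] [Fintype E] (ρ : E → ℝ) (U : ℝ) (J : Option E → ℝ) :
    M.SecondRule ρ U J ↔ ∃ h, C.IsPotential (drop ρ U J) h := by
  have key (d : Dart E) : ∑ x with M.facePerm.SameCycle d x, resistorVoltage ρ J x =
      ∑ x with M.facePerm.SameCycle d x, batteryVoltage U x ↔
      ∑ x with M.face x = M.face d, sign x * drop ρ U J x.1 = 0 := by
    simp only [← resistorVoltage_sub_batteryVoltage, Finset.sum_sub_distrib, sub_eq_zero,
      eq_comm (b := M.face d), face_eq_iff]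
  rw [SecondRule]
  simp only [key]
  simp only [← face_eq_iff]
  constructor
  · intro H
    have : Fintype M.Face := Fintype.ofFinite _
    -- The face function is normalized to vanish on the outer face, the only one where no rule is
    -- assumed.
    obtain ⟨⟨h, c⟩, hx⟩ := M.hodgeMap_surjective (drop ρ U J, 0, 0)
    obtain ⟨H₁, -, H₃⟩ : (∀ a, (h (C.finish a) - h (C.start a)) +
        (c (M.face (a, true)) - c (M.face (a, false))) = drop ρ U J a) ∧ h C.pos = 0 ∧
        c (M.face M.outer) = 0 := by
      simpa [hodgeMap, Prod.ext_iff, funext_iff] using hx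
    have hg : ∑ a, drop ρ U J a * (c (M.face (a, true)) - c (M.face (a, false))) = 0 := by
      rw [M.sum_mul_face, ← Finset.sum_fiberwise Finset.univ M.face]
      refine Finset.sum_eq_zero fun f _ => ?_
      obtain ⟨d, rfl⟩ : ∃ d, M.face d = f := Quotient.exists_rep f
      rw [Finset.sum_congr rfl fun x hx => by rw [(Finset.mem_filter.1 hx).2], ← Finset.mul_sum]
      by_cases hd : M.face M.outer = M.face d
      · rw [← hd, H₃, zero_mul]
      · rw [H d hd, mul_zero]
    refine ⟨h, fun a => ?_⟩
    rw [← H₁ a, M.face_eq_of_sum_mul_eq_zero H₁ hg a, sub_self, add_zero]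
  · rintro ⟨h, H⟩ d -
    rw [← M.sum_mul_tgt_sub_src (c := fun x => if M.face x = M.face d then 1 else 0)
      (fun x => by rw [face_facePerm]) h, Finset.sum_filter]
    simp only [H.sign_mul, ite_mul, one_mul, zero_mul]

end PlaneDrawing

/-! ### The linear system for the potentials and the currents -/

lemma FirstRule.sum_mul_eq_zero [Fintype V] [Fintype E] {C : CircuitGraph V E} {J : Option E → ℝ}
    (hJ : C.FirstRule J) (h : V → ℝ) : ∑ a, J a * (h (C.finish a) - h (C.start a)) = 0 := by
  classical
  simp only [mul_sub, Finset.sum_sub_distrib, sub_eq_zero]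
  rw [← Finset.sum_fiberwise Finset.univ C.finish, ← Finset.sum_fiberwise Finset.univ C.start]
  refine Finset.sum_congr rfl fun v _ => ?_
  have h₁ : ∑ a with C.finish a = v, J a * h (C.finish a) = (∑ a with C.finish a = v, J a) * h v := by
    rw [Finset.sum_mul]
    exact Finset.sum_congr rfl fun a ha => by rw [(Finset.mem_filter.1 ha).2]
  have h₂ : ∑ a with C.start a = v, J a * h (C.start a) = (∑ a with C.start a = v, J a) * h v := by
    rw [Finset.sum_mul]
    exact Finset.sum_congr rfl fun a ha => by rw [(Finset.mem_filter.1 ha).2]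
  rw [h₁, h₂]
  congr 1
  convert hJ v

/-- Conservation of energy: currents satisfying the first rule are orthogonal to coboundaries, in
particular to `drop ρ U J`. -/
lemma FirstRule.sum_energy [Fintype V] [Fintype E] {C : CircuitGraph V E} {J : Option E → ℝ}
    (hJ : C.FirstRule J) {ρ : E → ℝ} {U : ℝ} {h : V → ℝ} (H : C.IsPotential (drop ρ U J) h) :
    ∑ e, ρ e * J (some e) ^ 2 = J none * U := by
  have := hJ.sum_mul_eq_zero h
  simp only [fun a => show h (C.finish a) - h (C.start a) = _ from H a, Fintype.sum_option, drop] at this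
  have h2 : ∑ e, ρ e * J (some e) ^ 2 = ∑ e, J (some e) * (J (some e) * ρ e) :=
    Finset.sum_congr rfl fun e _ => by ring
  linarith

lemma FirstRule.current_eq_zero [Fintype V] [Fintype E] {C : CircuitGraph V E} {J : Option E → ℝ}
    (hJ : C.FirstRule J) {ρ : E → ℝ} (hρ : ∀ e, 0 < ρ e) {U : ℝ} {h : V → ℝ}
    (H : C.IsPotential (drop ρ U J) h) (h0 : J none * U = 0) (e : E) : J (some e) = 0 := by
  have := hJ.sum_energy H
  rw [h0, Finset.sum_eq_zero_iff_of_nonneg fun e _ => mul_nonneg (hρ e).le (sq_nonneg _)] at this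
  simpa [(hρ e).ne'] using this e (Finset.mem_univ e)

section Matrix

variable {R : Type*} [CommRing R]

open scoped Classical in
/-- The incidence matrix. -/
noncomputable def incidence (R : Type*) [CommRing R] : Matrix V (Option E) R :=
  Matrix.of fun v a => (if C.finish a = v then 1 else 0) - (if C.start a = v then 1 else 0)

open scoped Classical in
/-- The matrix of the linear system for the potentials of the vertices and the currents through the
edges. The potential of the negative pole is added to the first rule at that pole, which forces this
potential to vanish. -/
noncomputable def systemMatrix (r : E → R) : Matrix (V ⊕ Option E) (V ⊕ Option E) R :=
  Matrix.fromBlocks (Matrix.diagonal (Pi.single C.neg 1)) (C.incidence R) (-(C.incidence R)ᵀ)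
    (Matrix.diagonal fun a => a.elim 0 r)

lemma map_systemMatrix {S : Type*} [CommRing S] (φ : R →+* S) (r : E → R) :
    (C.systemMatrix r).map φ = C.systemMatrix fun e => φ (r e) := by
  ext (v | a) (w | b)
  · simp [systemMatrix, Matrix.diagonal_apply, Pi.single_apply, apply_ite φ]
  · simp [systemMatrix, incidence, apply_ite φ]
  · simp [systemMatrix, incidence, apply_ite φ]
  · rcases a with _ | e <;> simp [systemMatrix, Matrix.diagonal_apply, apply_ite φ]

end Matrix

open scoped Classical in
lemma firstRule_iff [Fintype E] (J : Option E → ℝ) : C.FirstRule J ↔ C.incidence ℝ *ᵥ J = 0 := by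
  rw [funext_iff]
  refine forall_congr' fun v => ?_
  simp only [Matrix.mulVec, dotProduct, incidence, Matrix.of_apply, sub_mul, Finset.sum_sub_distrib,
    Pi.zero_apply, sub_eq_zero, ite_mul, one_mul, zero_mul, Finset.sum_filter]

variable [Fintype V] [Fintype E]

lemma sum_incidence_mulVec (J : Option E → ℝ) : ∑ v, (C.incidence ℝ *ᵥ J) v = 0 := by
  classical
  simp only [Matrix.mulVec, dotProduct]
  rw [Finset.sum_comm]
  refine Finset.sum_eq_zero fun a _ => ?_
  simp [← Finset.sum_mul, incidence]

open scoped Classical in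
lemma systemMatrix_mulVec_iff (ρ : E → ℝ) (U : ℝ) (h : V → ℝ) (J : Option E → ℝ) :
    C.systemMatrix ρ *ᵥ Sum.elim h J = Pi.single (Sum.inr none) U ↔
      C.FirstRule J ∧ h C.neg = 0 ∧ C.IsPotential (drop ρ U J) h := by
  have hinl (v : V) : (C.systemMatrix ρ *ᵥ Sum.elim h J) (Sum.inl v) =
      (Pi.single C.neg (h C.neg) : V → ℝ) v + (C.incidence ℝ *ᵥ J) v := by
    simp only [systemMatrix, Matrix.fromBlocks_mulVec, Sum.elim_comp_inl, Sum.elim_comp_inr,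
      Sum.elim_inl, Pi.add_apply, Matrix.mulVec_diagonal, Pi.single_apply]
    split_ifs with hv
    · rw [hv, one_mul]
    · rw [zero_mul]
  have hinr (a : Option E) : (C.systemMatrix ρ *ᵥ Sum.elim h J) (Sum.inr a) =
      h (C.start a) - h (C.finish a) + a.elim 0 ρ * J a := by
    simp only [systemMatrix, Matrix.fromBlocks_mulVec, Sum.elim_comp_inl, Sum.elim_comp_inr,
      Sum.elim_inr, Pi.add_apply, Matrix.mulVec_diagonal]
    simp [Matrix.mulVec, dotProduct, incidence, sub_mul, Finset.sum_sub_distrib]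
  have hpot : (∀ a, h (C.start a) - h (C.finish a) + a.elim 0 ρ * J a =
      (Pi.single (Sum.inr none) U : V ⊕ Option E → ℝ) (Sum.inr a)) ↔
      C.IsPotential (drop ρ U J) h := by
    refine forall_congr' fun a => ?_
    rcases a with _ | e
    · simp only [Option.elim, drop, Pi.single_eq_same]
      constructor <;> intro H <;> linarith
    · rw [Pi.single_eq_of_ne (by simp)]
      simp only [Option.elim, drop]
      constructor <;> intro H <;> linarith
  rw [funext_iff, Sum.forall, firstRule_iff]
  simp only [hinl, hinr, hpot, ← and_assoc]
  refine and_congr_left fun _ => ?_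
  simp only [Pi.single_eq_of_ne (Sum.inl_ne_inr (b := (none : Option E)))]
  constructor
  · intro H
    have h0 : h C.neg = 0 := by
      -- Summing the vertex equations cancels all currents, leaving only the added term `h C.neg`.
      have := Finset.sum_congr rfl fun v (_ : v ∈ Finset.univ) => H v
      simpa [Finset.sum_add_distrib, C.sum_incidence_mulVec] using this
    exact ⟨funext fun v => by simpa [h0] using H v, h0⟩
  · rintro ⟨H, h0⟩ v
    simp [H, h0]

lemma current_eq_zero_and_potential_eq_zero {ρ : E → ℝ} (hρ : ∀ e, 0 < ρ e) {h : V → ℝ}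
    {J : Option E → ℝ} (hJ : C.FirstRule J) (h0 : h C.neg = 0)
    (H : C.IsPotential (drop ρ 0 J) h) : h = 0 ∧ J = 0 := by
  classical
  have hres := hJ.current_eq_zero hρ H (mul_zero _)
  have hdrop : drop ρ 0 J = 0 := by
    ext (_ | e) <;> simp [drop, hres]
  rw [hdrop] at H
  refine ⟨funext fun v => (C.eq_of_isPotential_zero H v C.neg).trans h0, ?_⟩
  -- The energy identity says nothing about the battery current; with all resistor currents zero,
  -- the first rule at `C.pos` kills it.
  have hpos := hJ C.pos
  rw [Finset.sum_filter, Finset.sum_filter, Fintype.sum_option, Fintype.sum_option] at hpos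
  simp only [hres, ite_self, Finset.sum_const_zero, add_zero] at hpos
  rw [if_pos (show C.finish none = C.pos from rfl),
    if_neg (show C.start none ≠ C.pos from C.pos_ne_neg.symm)] at hpos
  ext (_ | e)
  · exact hpos
  · exact hres e

open scoped Classical in
lemma det_systemMatrix_ne_zero {ρ : E → ℝ} (hρ : ∀ e, 0 < ρ e) : (C.systemMatrix ρ).det ≠ 0 := by
  rw [Ne, ← Matrix.exists_mulVec_eq_zero_iff]
  rintro ⟨x, hx, hx0⟩
  rw [← Sum.elim_comp_inl_inr x, ← Pi.single_zero (Sum.inr none : V ⊕ Option E),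
    systemMatrix_mulVec_iff] at hx0
  obtain ⟨h₁, h₂⟩ := C.current_eq_zero_and_potential_eq_zero hρ hx0.1 hx0.2.1 hx0.2.2
  refine hx ?_
  rw [← Sum.elim_comp_inl_inr x, h₁, h₂, Sum.elim_zero_zero]

open scoped Classical in
/-- The currents are determined by Cramer's rule. -/
lemma firstRule_and_exists_isPotential_iff {ρ : E → ℝ} (hρ : ∀ e, 0 < ρ e) (U : ℝ)
    (J : Option E → ℝ) : (C.FirstRule J ∧ ∃ h, C.IsPotential (drop ρ U J) h) ↔
      J = fun a => (C.systemMatrix ρ).adjugate (Sum.inr a) (Sum.inr none) * U /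
        (C.systemMatrix ρ).det := by
  have hdet := C.det_systemMatrix_ne_zero hρ
  set A := C.systemMatrix ρ with hA
  have hsol (x : V ⊕ Option E → ℝ) : A *ᵥ x = Pi.single (Sum.inr none) U ↔
      x = fun i => A.adjugate i (Sum.inr none) * U / A.det := by
    have hx (x : V ⊕ Option E → ℝ) : A⁻¹ *ᵥ (A *ᵥ x) = x := by
      rw [Matrix.mulVec_mulVec, Matrix.nonsing_inv_mul _ hdet.isUnit, Matrix.one_mulVec]
    have hx' (x : V ⊕ Option E → ℝ) : A *ᵥ (A⁻¹ *ᵥ x) = x := by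
      rw [Matrix.mulVec_mulVec, Matrix.mul_nonsing_inv _ hdet.isUnit, Matrix.one_mulVec]
    have hinv : A⁻¹ *ᵥ Pi.single (Sum.inr none) U =
        fun i => A.adjugate i (Sum.inr none) * U / A.det := by
      ext i
      rw [Matrix.mulVec_single, Matrix.inv_def, Ring.inverse_eq_inv']
      simp
      ring
    rw [← hinv]
    exact ⟨fun h => by rw [← h, hx], fun h => by rw [h, hx']⟩
  constructor
  · rintro ⟨hJ, h, H⟩
    -- A potential is determined up to a constant; it is shifted to vanish at the negative pole.
    have := (hsol _).1 ((C.systemMatrix_mulVec_iff ρ U (fun v => h v - h C.neg) J).2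
      ⟨hJ, sub_self _, fun a => by rw [← H a]; ring⟩)
    exact funext fun a => congrFun this (Sum.inr a)
  · rintro rfl
    have := (hsol _).2 rfl
    rw [← Sum.elim_comp_inl_inr fun i => A.adjugate i (Sum.inr none) * U / A.det,
      systemMatrix_mulVec_iff] at this
    exact ⟨this.1, _, this.2.2⟩

/-- With no battery current there is no energy, hence no resistor current. Then `h` is constant
along the chain joining the poles, although its values there differ by `U`. -/
lemma battery_current_ne_zero (hC : C.PolesJoined) {ρ : E → ℝ} (hρ : ∀ e, 0 < ρ e) {U : ℝ}
    (hU : 0 < U) {J : Option E → ℝ} (hJ : C.FirstRule J) {h : V → ℝ}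
    (H : C.IsPotential (drop ρ U J) h) : J none ≠ 0 := by
  intro h0
  have hres := hJ.current_eq_zero hρ H (by rw [h0, zero_mul])
  have heq : h C.pos = h C.neg := by
    refine hC.apply_pos_eq fun e => ?_
    have : h (C.head e) - h (C.tail e) = J (some e) * ρ e := H (some e)
    rw [hres, zero_mul] at this
    exact (sub_eq_zero.1 this).symm
  have : h C.pos - h C.neg = -U := H none
  linarith

end CircuitGraph

/-! ### Integer polynomials as formulas without constants -/

namespace ArithFormula

variable {E : Type*}

/-- Every polynomial with integer coefficients is the value of a formula without constants. -/
lemma exists_eval_eq_aeval [Nonempty E] (p : MvPolynomial E ℤ) : ∃ f : ArithFormula E,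
    ∀ ρ : E → ℝ, (∀ e, 0 < ρ e) → f.Defined ρ ∧ f.eval ρ = MvPolynomial.aeval ρ p := by
  obtain ⟨e⟩ := ‹Nonempty E›
  induction p using MvPolynomial.induction_on with
  | C n =>
    -- Integers are built from `0 = e - e` and `1 = e / e`; the division is legitimate as
    -- resistances are positive.
    induction n with
    | zero => exact ⟨sub (var e) (var e), fun ρ _ => by simp [Defined, eval]⟩
    | succ n ih =>
      obtain ⟨f, hf⟩ := ih
      refine ⟨add f (div (var e) (var e)), fun ρ hρ => ?_⟩
      have := hf ρ hρ
      have he := (hρ e).ne'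
      simp_all [Defined, eval]
    | pred n ih =>
      obtain ⟨f, hf⟩ := ih
      refine ⟨sub f (div (var e) (var e)), fun ρ hρ => ?_⟩
      have := hf ρ hρ
      have he := (hρ e).ne'
      simp_all [Defined, eval]
  | add p q hp hq =>
    obtain ⟨f, hf⟩ := hp
    obtain ⟨g, hg⟩ := hq
    exact ⟨add f g, fun ρ hρ => ⟨⟨(hf ρ hρ).1, (hg ρ hρ).1⟩, by
      rw [eval, (hf ρ hρ).2, (hg ρ hρ).2, map_add]⟩⟩
  | mul_X p i hp =>
    obtain ⟨f, hf⟩ := hp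
    exact ⟨mul f (var i), fun ρ hρ => ⟨⟨(hf ρ hρ).1, trivial⟩, by
      rw [eval, (hf ρ hρ).2, map_mul, MvPolynomial.aeval_X, eval]⟩⟩

end ArithFormula

/-! ### The total resistance as determinant over cofactor -/

namespace CircuitGraph

variable {V E : Type*} (C : CircuitGraph V E)

lemma PlaneDrawing.kirchhoff_iff [Fintype V] [Fintype E] {C : CircuitGraph V E}
    (M : C.PlaneDrawing) (ρ : E → ℝ) (U : ℝ) (J : Option E → ℝ) :
    M.Kirchhoff ρ U J ↔ C.Kirchhoff ρ U J := by
  rw [PlaneDrawing.Kirchhoff, CircuitGraph.Kirchhoff, M.secondRule_iff, C.secondRule_iff]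

open scoped Classical in
lemma isTotalResistance_kirchhoff [Fintype V] [Fintype E] (hC : C.PolesJoined) {ρ : E → ℝ}
    (hρ : ∀ e, 0 < ρ e) {U : ℝ} (hU : 0 < U) :
    (C.systemMatrix ρ).adjugate (Sum.inr none) (Sum.inr none) ≠ 0 ∧
      IsTotalResistance (C.Kirchhoff ρ U) U ((C.systemMatrix ρ).det /
        (C.systemMatrix ρ).adjugate (Sum.inr none) (Sum.inr none)) := by
  have key (J) : C.Kirchhoff ρ U J ↔ _ :=
    (and_congr_right' (C.secondRule_iff ρ U J)).trans
      (C.firstRule_and_exists_isPotential_iff hρ U J)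
  obtain ⟨hJ, h, H⟩ := (C.firstRule_and_exists_isPotential_iff hρ U _).2 rfl
  have hne := C.battery_current_ne_zero hC hρ hU hJ H
  have hadj : (C.systemMatrix ρ).adjugate (Sum.inr none) (Sum.inr none) ≠ 0 := by
    intro h0
    simp [h0] at hne
  have hdet := C.det_systemMatrix_ne_zero hρ
  refine ⟨hadj, _, (key _).2 rfl, fun J' hJ' => (key J').1 hJ', hne, ?_⟩
  field_simp

end CircuitGraph

theorem mainTheorem5 {V E : Type*} [Fintype V] [Fintype E] (C : CircuitGraph V E)
    (hC : C.PolesJoined) :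
    ∃ (f : ArithFormula E) (p q : MvPolynomial E ℤ), ∀ ρ : E → ℝ, (∀ e, 0 < ρ e) →
      f.Defined ρ ∧ MvPolynomial.aeval ρ q ≠ 0 ∧
      f.eval ρ = MvPolynomial.aeval ρ p / MvPolynomial.aeval ρ q ∧
      ∀ U : ℝ, 0 < U →
        CircuitGraph.IsTotalResistance (C.Kirchhoff ρ U) U (f.eval ρ) ∧
        ∀ M : C.PlaneDrawing,
          CircuitGraph.IsTotalResistance (M.Kirchhoff ρ U) U (f.eval ρ) := by
  classical
  have := hC.nonempty
  -- Working with indeterminate resistances makes `p` and `q` depend on the graph alone; evaluation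
  -- at `ρ` commutes with determinant and adjugate.
  let A : Matrix (V ⊕ Option E) (V ⊕ Option E) (MvPolynomial E ℤ) := C.systemMatrix MvPolynomial.X
  obtain ⟨f, hf⟩ := ArithFormula.exists_eval_eq_aeval A.det
  obtain ⟨g, hg⟩ := ArithFormula.exists_eval_eq_aeval (A.adjugate (Sum.inr none) (Sum.inr none))
  refine ⟨f.div g, A.det, A.adjugate (Sum.inr none) (Sum.inr none), fun ρ hρ => ?_⟩
  have hA : (MvPolynomial.aeval ρ : MvPolynomial E ℤ →ₐ[ℤ] ℝ).toRingHom.mapMatrix A =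
      C.systemMatrix ρ := by
    refine (C.map_systemMatrix _ _).trans ?_
    congr 1
    exact funext fun e => MvPolynomial.aeval_X ρ e
  have hp : MvPolynomial.aeval ρ A.det = (C.systemMatrix ρ).det := by
    rw [← hA, ← RingHom.map_det]
    rfl
  have hq : MvPolynomial.aeval ρ (A.adjugate (Sum.inr none) (Sum.inr none)) =
      (C.systemMatrix ρ).adjugate (Sum.inr none) (Sum.inr none) := by
    rw [← hA, ← RingHom.map_adjugate]
    rfl
  have hq0 := (C.isTotalResistance_kirchhoff hC hρ one_pos).1
  have hfg : (f.div g).eval ρ = (C.systemMatrix ρ).det /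
      (C.systemMatrix ρ).adjugate (Sum.inr none) (Sum.inr none) := by
    rw [ArithFormula.eval, (hf ρ hρ).2, (hg ρ hρ).2, hp, hq]
  refine ⟨⟨(hf ρ hρ).1, (hg ρ hρ).1, by rwa [(hg ρ hρ).2, hq]⟩, by rwa [hq], by rw [hfg, hp, hq],
    fun U hU => ?_⟩
  have hR := (C.isTotalResistance_kirchhoff hC hρ hU).2
  rw [hfg]
  refine ⟨hR, fun M => ?_⟩
  rwa [show M.Kirchhoff ρ U = C.Kirchhoff ρ U from funext fun J => propext (M.kirchhoff_iff ρ U J)]
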